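/- A (finite) hypergraph $H=(V,E)$ consists of a finite vertex set $V$ and a set $E$ of subsets of $V$, called hyperedges. It is $K$-uniform if every hyperedge has exactly $K$ vertices, and simple if any two distinct hyperedges have at most one vertex in common. The degree of a vertex is the number of hyperedges containing it, and the maximum degree of $H$ is the largest degree of a vertex. A (proper) $q$-colouring of $H$ is a map $\sigma:V\to\{1,\dots,q\}$ under which no hyperedge is monochromatic, and $H$ is $q$-colourable if it has such a colouring. Let $q,K\ge 2$ be integers. Then, for every integer $\Delta>Kq^{K-1}\ln q+1$, there exist a $q$-colourable simple $K$-uniform hypergraph $H$ with maximum degree $\Delta$ and two distinct vertices $u,v$ of $H$ such that the degree of $u$ is $1$, the degree of $v$ is at most $\Delta$, and $\sigma(u)\neq\sigma(v)$ for every $q$-colouring $\sigma$ of $H$. -/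

import Mathlib

namespace Hypergraph

variable {V : Type*}

/-- Every hyperedge of `H` has exactly `K` vertices (used here for `K ≥ 2`). -/
def KUniform (H : Hypergraph V) (K : ℕ) : Prop :=
  ∀ e ∈ H.edgeSet, e.ncard = K

/-- `H` is simple (or linear): any two distinct hyperedges share at most one vertex. -/
def Simple (H : Hypergraph V) : Prop :=
  ∀ e ∈ H.edgeSet, ∀ f ∈ H.edgeSet, e ≠ f → (e ∩ f).encard ≤ 1

/-- The degree of a vertex is the number of hyperedges containing it (used here for finite `V`). -/
noncomputable def vertexDegree (H : Hypergraph V) (w : V) : ℕ :=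
  {e ∈ H.edgeSet | w ∈ e}.ncard

/-- The maximum of the vertex degrees of `H` is attained and equals `D`. -/
def HasMaxDegree (H : Hypergraph V) (D : ℕ) : Prop :=
  IsGreatest (H.vertexDegree '' H.vertexSet) D

/-- `σ` is a proper `q`-colouring of `H`: no hyperedge is monochromatic. -/
def ProperColouring (H : Hypergraph V) {q : ℕ} (σ : V → Fin q) : Prop :=
  ∀ e ∈ H.edgeSet, ∃ x ∈ e, ∃ y ∈ e, σ x ≠ σ y

/-- `H` has a proper `q`-colouring. -/
def QColourable (H : Hypergraph V) (q : ℕ) : Prop :=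
  ∃ σ : V → Fin q, H.ProperColouring σ

end Hypergraph

open Finset

/-! The core is a linear `K`-uniform family of degree at most Δ with no proper `q`-colouring, built
greedily. The hypothesis leaves room for `δ < q ^ (1 - K)` with `q ^ K * (1 - δ) ^ Δ < 1`. A random
`K`-tuple of unsaturated vertices (degree below Δ) is monochromatic under any fixed colouring with
probability at least `q ^ (1 - K)`, and few tuples violate linearity. So averaging gives an
admissible edge that kills a fraction `δ` of the surviving colourings
(`IsLinearFamily.exists_extension`). Running out of unsaturated vertices would require about `n * Δ
/ K` edges, after which fewer than one of the `q ^ n` colourings could survive.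

In a minimal non-colourable subfamily, every colouring proper on the edges other than `e` is
constant on `e`. Replacing a vertex of `e` by a new vertex `u` therefore forces `u` to differ from
each vertex `v` kept in `e` (`IsLinearFamily.exists_separating`). This may leave the maximum degree
below Δ, so a disjoint star of degree Δ is added. -/

/-- A `K`-uniform family of finite sets, any two of which share at most one element, such that
every element lies in at most `D` members. -/
structure IsLinearFamily {V : Type*} [DecidableEq V] (K D : ℕ) (E : Finset (Finset V)) : Prop where
  card_eq : ∀ e ∈ E, #e = K
  card_inter_le : ∀ e ∈ E, ∀ f ∈ E, e ≠ f → #(e ∩ f) ≤ 1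
  degree_le : ∀ v, #{e ∈ E | v ∈ e} ≤ D

/-- `σ` is constant on `e`. -/
def IsMonochromatic {V C : Type*} (σ : V → C) (e : Finset V) : Prop :=
  ∀ x ∈ e, ∀ y ∈ e, σ x = σ y

lemma isMonochromatic_map {V V' C : Type*} (σ : V' → C) (φ : V ↪ V') (e : Finset V) :
    IsMonochromatic σ (e.map φ) ↔ IsMonochromatic (σ ∘ φ) e := by
  simp [IsMonochromatic]

/-! ### Greedy construction of a non-colourable linear family -/

section Greedy

open scoped Classical

variable {V : Type*}

/-- At most `K * D + 1` elements share a member of the family with a given `x` or equal it. -/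
lemma IsLinearFamily.card_neighbours_le [DecidableEq V] {K D : ℕ} {E : Finset (Finset V)}
    (hE : IsLinearFamily K D E) (A : Finset V) (x : V) :
    #{y ∈ A | x = y ∨ ∃ f ∈ E, x ∈ f ∧ y ∈ f} ≤ K * D + 1 := by
  have hsub : {y ∈ A | x = y ∨ ∃ f ∈ E, x ∈ f ∧ y ∈ f} ⊆
      insert x ({f ∈ E | x ∈ f}.biUnion id) := by
    intro y
    simp only [mem_filter, mem_insert, mem_biUnion, id]
    rintro ⟨-, rfl | ⟨f, hf, hx, hy⟩⟩
    · exact Or.inl rfl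
    · exact Or.inr ⟨f, ⟨hf, hx⟩, hy⟩
  have hbi : #({f ∈ E | x ∈ f}.biUnion id) ≤ #{f ∈ E | x ∈ f} * K :=
    card_biUnion_le_card_mul _ _ _ fun f hf => (hE.card_eq f (mem_filter.1 hf).1).le
  have := (card_le_card hsub).trans (card_insert_le _ _)
  have := Nat.mul_le_mul_right K (hE.degree_le x)
  rw [mul_comm K D]
  omega

/-- If every `x` is related to at most `B` elements of `A`, then at most `B * #A ^ (K - 1)` tuples
in `A` have related entries at two given positions. -/
lemma card_tuples_related_le {K B : ℕ} (A : Finset V) (R : V → V → Prop)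
    (hR : ∀ x, #{y ∈ A | R x y} ≤ B) {i j : Fin K} (hij : i ≠ j) :
    #{t ∈ Fintype.piFinset (fun _ : Fin K => A) | R (t i) (t j)} ≤ B * #A ^ (K - 1) := by
  have hcard : #(Fintype.piFinset (fun _ : {k : Fin K // k ≠ j} => A)) = #A ^ (K - 1) := by
    simp [Fintype.card_subtype_compl]
  rw [← hcard]
  -- Forget entry `j`: each remaining tuple has at most `B` completions, since its entry `i`
  -- restricts the entry `j`.
  refine card_le_mul_card_image_of_maps_to
    (f := fun (t : Fin K → V) (k : {k : Fin K // k ≠ j}) => t k) ?_ B ?_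
  · intro t ht
    rw [mem_filter, Fintype.mem_piFinset] at ht
    exact Fintype.mem_piFinset.2 fun k => ht.1 k
  · intro b _
    refine le_trans ?_ (hR (b ⟨i, hij⟩))
    refine card_le_card_of_injOn (fun t => t j) ?_ ?_
    · intro t ht
      simp only [coe_filter, mem_filter, Fintype.mem_piFinset, Set.mem_ofPred_eq] at ht ⊢
      obtain ⟨⟨ht, hr⟩, rfl⟩ := ht
      exact ⟨ht j, hr⟩
    · intro t ht s hs hts
      simp only [coe_filter, mem_filter, Set.mem_ofPred_eq] at ht hs
      funext k
      by_cases hk : k = j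
      · exact hk ▸ hts
      · exact congrFun (ht.2.trans hs.2.symm) ⟨k, hk⟩

/-- Among the `K`-tuples in `A`, at least a fraction `q ^ (1 - K)` is constant under a given
`q`-colouring. -/
lemma pow_le_mul_card_monochromatic_tuples {q K : ℕ} (A : Finset V) (σ : V → Fin q) (hK : 1 ≤ K) :
    #A ^ K ≤ q ^ (K - 1) *
      #{t ∈ Fintype.piFinset (fun _ : Fin K => A) | ∀ i j, σ (t i) = σ (t j)} := by
  obtain ⟨k, rfl⟩ : ∃ k, K = k + 1 := ⟨K - 1, by omega⟩
  have hsum : #A = ∑ c : Fin q, #{v ∈ A | σ v = c} :=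
    card_eq_sum_card_fiberwise fun _ _ => mem_coe.2 (mem_univ _)
  -- Power mean inequality for the colour class sizes: their `K`-th powers sum to the number of
  -- monochromatic tuples.
  have hpow := pow_sum_le_card_mul_sum_pow (s := univ) (f := fun c : Fin q => #{v ∈ A | σ v = c})
    (fun _ _ => Nat.zero_le _) k
  rw [← hsum] at hpow
  simp only [card_univ, Fintype.card_fin] at hpow
  refine hpow.trans (Nat.mul_le_mul_left _ ?_)
  rw [card_eq_sum_card_fiberwise (f := fun t : Fin (k + 1) → V => σ (t 0)) (t := univ)
    fun _ _ => mem_coe.2 (mem_univ _)]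
  refine sum_le_sum fun c _ => ?_
  have hpi : #(Fintype.piFinset fun _ : Fin (k + 1) => {v ∈ A | σ v = c}) =
      #{v ∈ A | σ v = c} ^ (k + 1) := by simp
  rw [← hpi]
  refine card_le_card fun t ht => ?_
  simp only [Fintype.mem_piFinset, mem_filter] at ht ⊢
  exact ⟨⟨fun a => (ht a).1, fun i j => (ht i).2.trans (ht j).2.symm⟩, (ht 0).2⟩

/-- While `A` is large, a linear family can be extended by a set in `A` that is monochromatic
for a fraction `δ < q ^ (1 - K)` of any given collection of colourings. -/
lemma IsLinearFamily.exists_extension [DecidableEq V] {q K D : ℕ}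
    {E : Finset (Finset V)} (hE : IsLinearFamily K D E) (hK : 1 ≤ K) (A : Finset V) (S : Finset (V → Fin q))
    (hS : S.Nonempty) {δ : ℝ} (hδ : 0 < δ) (hA : 0 < #A)
    (hlarge : (K ^ 2 * (K * D + 1) : ℝ) ≤ #A * (1 / (q : ℝ) ^ (K - 1) - δ)) :
    ∃ e ⊆ A, #e = K ∧ (∀ f ∈ E, #(e ∩ f) ≤ 1) ∧
      δ * #S ≤ #{σ ∈ S | IsMonochromatic σ e} := by
  -- A tuple with pairwise unrelated entries is injective, by the equality case, and meets each
  -- member of `E` at most once.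
  set R : V → V → Prop := fun x y => x = y ∨ ∃ f ∈ E, x ∈ f ∧ y ∈ f with hRdef
  set T := Fintype.piFinset (fun _ : Fin K => A) with hT
  have hTcard : #T = #A ^ K := by simp [hT]
  set G := {t ∈ T | ∀ i j, i ≠ j → ¬ R (t i) (t j)} with hG
  have hq : 0 < q := by
    obtain ⟨σ, -⟩ := hS
    obtain ⟨a, -⟩ := card_pos.1 hA
    exact (σ a).pos
  -- The bad tuples are of order `#A ^ (K - 1)`, negligible against the `#A ^ K` tuples in all.
  have hbad : #{t ∈ T | ∃ i j, i ≠ j ∧ R (t i) (t j)} ≤ K ^ 2 * ((K * D + 1) * #A ^ (K - 1)) := by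
    have hsub : {t ∈ T | ∃ i j, i ≠ j ∧ R (t i) (t j)} ⊆
        ({p : Fin K × Fin K | p.1 ≠ p.2} : Finset _).biUnion
          fun p => {t ∈ T | R (t p.1) (t p.2)} := by
      intro t
      simp only [mem_filter, mem_biUnion, mem_univ, true_and, Prod.exists]
      rintro ⟨ht, i, j, hij, hr⟩
      exact ⟨i, j, hij, ht, hr⟩
    refine (card_le_card hsub).trans ((card_biUnion_le_card_mul _ _ ((K * D + 1) * #A ^ (K - 1))
      fun p hp => ?_).trans (Nat.mul_le_mul_right _ ?_))
    · convert card_tuples_related_le A R (B := K * D + 1) (fun x => by convert hE.card_neighbours_le A x)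
        (mem_filter.1 hp).2
    · refine (card_filter_le _ _).trans ?_
      simp [sq]
  have hgood : ∀ σ ∈ S, δ * (#A : ℝ) ^ K ≤ #{t ∈ G | ∀ i j, σ (t i) = σ (t j)} := by
    intro σ _
    have hmono := pow_le_mul_card_monochromatic_tuples A σ hK
    have hsplit : #{t ∈ T | ∀ i j, σ (t i) = σ (t j)} ≤
        #{t ∈ G | ∀ i j, σ (t i) = σ (t j)} + #{t ∈ T | ∃ i j, i ≠ j ∧ R (t i) (t j)} := by
      refine (card_le_card fun t ht => ?_).trans (card_union_le _ _)
      simp only [hG, mem_union, mem_filter] at ht ⊢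
      by_cases hb : ∃ i j, i ≠ j ∧ R (t i) (t j)
      · exact Or.inr ⟨ht.1, hb⟩
      · push Not at hb
        exact Or.inl ⟨⟨ht.1, hb⟩, ht.2⟩
    have h1 : (#A : ℝ) ^ K ≤ (q : ℝ) ^ (K - 1) *
        (#{t ∈ G | ∀ i j, σ (t i) = σ (t j)} + K ^ 2 * ((K * D + 1) * (#A : ℝ) ^ (K - 1))) := by
      exact_mod_cast hmono.trans (Nat.mul_le_mul_left _ (hsplit.trans (Nat.add_le_add_left hbad _)))
    have hqpos : (0 : ℝ) < (q : ℝ) ^ (K - 1) := by positivity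
    rw [← div_le_iff₀' hqpos] at h1
    have h2 := mul_le_mul_of_nonneg_right hlarge (by positivity : (0 : ℝ) ≤ (#A : ℝ) ^ (K - 1))
    have h3 : (#A : ℝ) ^ K = #A * (#A : ℝ) ^ (K - 1) := by
      rw [← pow_succ', Nat.sub_add_cancel hK]
    rw [h3] at h1 ⊢
    have h4 : (#A : ℝ) * (1 / (q : ℝ) ^ (K - 1) - δ) * (#A : ℝ) ^ (K - 1) =
      #A * (#A : ℝ) ^ (K - 1) / (q : ℝ) ^ (K - 1) - δ * (#A * (#A : ℝ) ^ (K - 1)) := by ring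
    rw [h4] at h2
    linarith
  have hApos : (0 : ℝ) < (#A : ℝ) ^ K := by positivity
  have hGne : G.Nonempty := by
    obtain ⟨σ, hσ⟩ := hS
    have : (0 : ℝ) < #{t ∈ G | ∀ i j, σ (t i) = σ (t j)} :=
      (mul_pos hδ hApos).trans_le (hgood σ hσ)
    exact (card_pos.1 (Nat.cast_pos.1 this)).mono (filter_subset _ _)
  -- Double counting of pairs (good tuple, colouring constant on it); some good tuple then does at
  -- least as well as average.
  have hdouble : ∑ t ∈ G, #{σ ∈ S | ∀ i j, σ (t i) = σ (t j)} =
      ∑ σ ∈ S, #{t ∈ G | ∀ i j, σ (t i) = σ (t j)} :=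
    sum_card_bipartiteAbove_eq_sum_card_bipartiteBelow
      (fun (t : Fin K → V) (σ : V → Fin q) => ∀ i j, σ (t i) = σ (t j))
  have hle : ∑ _t ∈ G, δ * (#S : ℝ) ≤
      ∑ t ∈ G, (#{σ ∈ S | ∀ i j, σ (t i) = σ (t j)} : ℝ) := by
    calc ∑ _t ∈ G, δ * (#S : ℝ) = #G * (δ * #S) := by simp
      _ ≤ (#A : ℝ) ^ K * (δ * #S) := by
        gcongr
        exact_mod_cast (card_filter_le _ _).trans hTcard.le
      _ = ∑ _σ ∈ S, δ * (#A : ℝ) ^ K := by simp; ring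
      _ ≤ ∑ σ ∈ S, (#{t ∈ G | ∀ i j, σ (t i) = σ (t j)} : ℝ) := sum_le_sum hgood
      _ = _ := by exact_mod_cast hdouble.symm
  obtain ⟨t, htG, ht⟩ := exists_le_of_sum_le hGne hle
  rw [hG, mem_filter, hT, Fintype.mem_piFinset] at htG
  have hinj : Function.Injective t := fun i j hij => by
    by_contra hne
    exact htG.2 i j hne (Or.inl hij)
  refine ⟨univ.image t, ?_, ?_, ?_, ?_⟩
  · intro x hx
    obtain ⟨i, -, rfl⟩ := mem_image.1 hx
    exact htG.1 i
  · rw [card_image_of_injective _ hinj, card_univ, Fintype.card_fin]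
  · intro f hf
    rw [card_le_one]
    intro x hx y hy
    simp only [mem_inter, mem_image, mem_univ, true_and] at hx hy
    obtain ⟨⟨i, rfl⟩, hi⟩ := hx
    obtain ⟨⟨j, rfl⟩, hj⟩ := hy
    by_contra hne
    exact htG.2 i j (fun h => hne (h ▸ rfl)) (Or.inr ⟨f, hf, hi, hj⟩)
  · refine ht.trans (Nat.cast_le.2 (card_le_card fun σ hσ => ?_))
    simp only [mem_filter] at hσ ⊢
    refine ⟨hσ.1, fun x hx y hy => ?_⟩
    obtain ⟨i, -, rfl⟩ := mem_image.1 hx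
    obtain ⟨j, -, rfl⟩ := mem_image.1 hy
    exact hσ.2 i j

/-- A linear family stays linear after adding a set of unsaturated elements that meets every member
in at most one element. -/
lemma IsLinearFamily.insert [DecidableEq V] {K D : ℕ} {E : Finset (Finset V)}
    (hE : IsLinearFamily K D E) {e : Finset V} (he : #e = K) (hdeg : ∀ v ∈ e, #{f ∈ E | v ∈ f} < D)
    (hinter : ∀ f ∈ E, #(e ∩ f) ≤ 1) : IsLinearFamily K D (insert e E) where
  card_eq f hf := by
    rcases mem_insert.1 hf with rfl | hf
    exacts [he, hE.card_eq f hf]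
  card_inter_le f hf g hg hfg := by
    rcases mem_insert.1 hf with rfl | hf <;> rcases mem_insert.1 hg with rfl | hg
    · exact absurd rfl hfg
    · exact hinter g hg
    · rw [inter_comm]
      exact hinter f ‹f ∈ E›
    · exact hE.card_inter_le f hf g hg hfg
  degree_le v := by
    rw [filter_insert]
    split_ifs with hv
    · exact (card_insert_le _ _).trans (hdeg v hv)
    · exact hE.degree_le v

/-- If `q ^ K * (1 - δ) ^ D < 1`, the greedy extension of linear families of degree at most `D`
eventually excludes all `q`-colourings. -/
theorem exists_isLinearFamily_not_colourable {q K D : ℕ} (hq : 1 ≤ q) (hK : 2 ≤ K) {δ : ℝ}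
    (hδ : 0 < δ) (hδq : δ < 1 / (q : ℝ) ^ (K - 1)) (hsmall : (q : ℝ) ^ K * (1 - δ) ^ D < 1) :
    ∃ (n : ℕ) (E : Finset (Finset (Fin n))), IsLinearFamily K D E ∧
      ∀ σ : Fin n → Fin q, ∃ e ∈ E, IsMonochromatic σ e := by
  have hδ1 : δ < 1 := hδq.trans_le (by
    rw [div_le_one (by positivity)]
    exact one_le_pow₀ (by exact_mod_cast hq))
  -- `N` is the number of unsaturated vertices that suffices for an extension step.
  obtain ⟨N, hN⟩ := exists_nat_ge ((K ^ 2 * (K * D + 1) : ℝ) / (1 / (q : ℝ) ^ (K - 1) - δ))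
  rw [div_le_iff₀ (sub_pos.2 hδq)] at hN
  have hNpos : 0 < N := by
    rcases Nat.eq_zero_or_pos N with rfl | h
    · have : (0 : ℝ) < K ^ 2 * (K * D + 1) := by positivity
      simp only [Nat.cast_zero, zero_mul] at hN
      linarith
    · exact h
  have hbase : 0 ≤ (q : ℝ) ^ K * (1 - δ) ^ D := by
    have := sub_pos.2 hδ1
    positivity
  -- With `k` vertices beyond `N`, the factor `(q ^ K * (1 - δ) ^ D) ^ k` outweighs the fixed cost
  -- `q ^ (K * N)`.
  obtain ⟨k, hk⟩ := exists_pow_lt_of_lt_one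
    (show (0 : ℝ) < 1 / (q : ℝ) ^ (K * N) by positivity) hsmall
  rw [lt_div_iff₀ (by positivity)] at hk
  set n := N + k with hn
  refine ⟨n, ?_⟩
  by_contra! hcol
  -- Under the assumption that every such family is colourable, the greedy process never stops.
  have hgrow : ∀ m : ℕ, ∃ E : Finset (Finset (Fin n)), IsLinearFamily K D E ∧ #E = m ∧
      (#{σ : Fin n → Fin q | ∀ e ∈ E, ¬ IsMonochromatic σ e} : ℝ) ≤ q ^ n * (1 - δ) ^ m := by
    intro m
    induction m with
    | zero =>
      refine ⟨∅, ⟨by simp, by simp, by simp⟩, rfl, ?_⟩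
      simp
    | succ m ih =>
      obtain ⟨E, hE, hm, hle⟩ := ih
      set S : Finset (Fin n → Fin q) := {σ | ∀ e ∈ E, ¬ IsMonochromatic σ e} with hSdef
      have hS : S.Nonempty := by
        obtain ⟨σ, hσ⟩ := hcol E hE
        exact ⟨σ, by simpa [hSdef] using hσ⟩
      set A : Finset (Fin n) := {v | #{f ∈ E | v ∈ f} < D} with hAdef
      have hAN : N ≤ #A := by
        by_contra! hlt
        -- Incidences at saturated vertices: at least `k` vertices of degree at least `D`, against
        -- `m` edges of size `K`.
        have hcount : D * k ≤ K * m := by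
          have hsum : ∑ e ∈ E, #(Aᶜ ∩ e) ≤ K * m := by
            rw [← hm, mul_comm, ← smul_eq_mul]
            refine sum_le_card_nsmul _ _ _ fun e he => ?_
            exact (card_le_card inter_subset_right).trans (hE.card_eq e he).le
          have hge : #Aᶜ * D ≤ ∑ e ∈ E, #(Aᶜ ∩ e) :=
            le_sum_card_inter fun v hv => by simpa [hAdef] using hv
          have hcompl : k ≤ #Aᶜ := by
            rw [card_compl, Fintype.card_fin]
            omega
          calc D * k = k * D := mul_comm _ _
            _ ≤ #Aᶜ * D := Nat.mul_le_mul_right _ hcompl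
            _ ≤ _ := hge.trans hsum
        have hone : (1 : ℝ) ≤ q ^ n * (1 - δ) ^ m :=
          le_trans (by exact_mod_cast card_pos.2 hS) hle
        -- The `K`-th power turns the exponent `m` into `K * m`, which `hcount` bounds below without
        -- division.
        have : (1 : ℝ) ≤ (q ^ n * (1 - δ) ^ m) ^ K := one_le_pow₀ hone
        have hlast : ((q : ℝ) ^ n * (1 - δ) ^ m) ^ K ≤
            ((q : ℝ) ^ K * (1 - δ) ^ D) ^ k * q ^ (K * N) := by
          have h1 : ((q : ℝ) ^ n * (1 - δ) ^ m) ^ K = q ^ (K * n) * (1 - δ) ^ (K * m) := by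
            rw [mul_pow, ← pow_mul, ← pow_mul, mul_comm n, mul_comm m]
          have h2 : ((q : ℝ) ^ K * (1 - δ) ^ D) ^ k * q ^ (K * N) =
              q ^ (K * n) * (1 - δ) ^ (D * k) := by
            rw [mul_pow, ← pow_mul, ← pow_mul, hn, mul_add, pow_add]
            ring
          rw [h1, h2]
          exact mul_le_mul_of_nonneg_left
            (pow_le_pow_of_le_one (by linarith) (by linarith) hcount) (by positivity)
        linarith
      obtain ⟨e, heA, hecard, hinter, hfrac⟩ :=
        hE.exists_extension (by omega) A S hS hδ (hNpos.trans_le hAN)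
          (hN.trans (mul_le_mul_of_nonneg_right (by exact_mod_cast hAN) (sub_pos.2 hδq).le))
      -- Otherwise `e` would meet itself in `K ≥ 2` elements.
      have heE : e ∉ E := fun he => by
        have := hinter e he
        rw [inter_self] at this
        omega
      refine ⟨insert e E, hE.insert hecard (fun v hv => by simpa [hAdef] using heA hv) hinter,
        by rw [card_insert_of_notMem heE, hm], ?_⟩
      have hsplit := card_filter_add_card_filter_not (s := S) (fun σ => IsMonochromatic σ e)
      have heq : ({σ : Fin n → Fin q | ∀ f ∈ insert e E, ¬ IsMonochromatic σ f} : Finset _) =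
          {σ ∈ S | ¬ IsMonochromatic σ e} := by
        ext σ
        simp [hSdef, and_comm]
      rw [heq]
      have hsplit' : (#{σ ∈ S | IsMonochromatic σ e} : ℝ) + #{σ ∈ S | ¬ IsMonochromatic σ e} = #S :=
        by exact_mod_cast hsplit
      calc (#{σ ∈ S | ¬ IsMonochromatic σ e} : ℝ) ≤ (1 - δ) * #S := by linarith
        _ ≤ (1 - δ) * (q ^ n * (1 - δ) ^ m) :=
          mul_le_mul_of_nonneg_left hle (by linarith)
        _ = _ := by ring
  -- After enough edges fewer than one colouring survives, contradicting colourability.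
  obtain ⟨m, hm⟩ := exists_pow_lt_of_lt_one
    (show (0 : ℝ) < 1 / (q : ℝ) ^ n by positivity) (show 1 - δ < 1 by linarith)
  rw [lt_div_iff₀ (by positivity)] at hm
  obtain ⟨E, hE, -, hle⟩ := hgrow m
  obtain ⟨σ, hσ⟩ := hcol E hE
  have hpos : 0 < #{σ : Fin n → Fin q | ∀ e ∈ E, ¬ IsMonochromatic σ e} :=
    card_pos.2 ⟨σ, by simpa using hσ⟩
  have : (1 : ℝ) ≤ #{σ : Fin n → Fin q | ∀ e ∈ E, ¬ IsMonochromatic σ e} := by exact_mod_cast hpos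
  linarith

end Greedy
-- Separating two vertices
section Gadget

open scoped Classical

/-- Replacing one element of a member of a minimal non-colourable linear family by a new element
`none` yields a colourable linear family in which `none` has degree one and every colouring
separates `none` from some other element. -/
lemma IsLinearFamily.exists_separating {V : Type*} [DecidableEq V] {q K D : ℕ} (hq : 2 ≤ q)
    (hK : 2 ≤ K) (hD : 1 ≤ D) {E : Finset (Finset V)} (hE : IsLinearFamily K D E)
    (hcol : ∀ σ : V → Fin q, ∃ e ∈ E, IsMonochromatic σ e) :
    ∃ F : Finset (Finset (Option V)), IsLinearFamily K D F ∧
      (∃ σ : Option V → Fin q, ∀ e ∈ F, ¬ IsMonochromatic σ e) ∧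
      #{e ∈ F | none ∈ e} = 1 ∧
      ∃ v : V, ∀ σ : Option V → Fin q, (∀ e ∈ F, ¬ IsMonochromatic σ e) → σ none ≠ σ (some v) := by
  have hq0 : NeZero q := ⟨by omega⟩
  obtain ⟨M, -, hmin⟩ := exists_minimal_le_of_wellFoundedLT
    (fun M : Finset (Finset V) => M ⊆ E ∧ ∀ σ : V → Fin q, ∃ e ∈ M, IsMonochromatic σ e)
    E ⟨Subset.rfl, hcol⟩
  obtain ⟨⟨hME, hMcol⟩, hMmin⟩ := hmin
  obtain ⟨e, heM, -⟩ := hMcol fun _ => 0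
  have hecard := hE.card_eq e (hME heM)
  obtain ⟨τ, hτ⟩ : ∃ τ : V → Fin q, ∀ f ∈ M.erase e, ¬ IsMonochromatic τ f := by
    by_contra! hno
    have := hMmin ⟨(erase_subset _ _).trans hME, hno⟩ (erase_subset e M)
    exact notMem_erase e M (this heM)
  have hmono : ∀ σ : V → Fin q, (∀ f ∈ M.erase e, ¬ IsMonochromatic σ f) →
      IsMonochromatic σ e := by
    intro σ hσ
    obtain ⟨f, hf, hfm⟩ := hMcol σ
    by_cases hfe : f = e
    · exact hfe ▸ hfm
    · exact absurd hfm (hσ f (mem_erase.2 ⟨hfe, hf⟩))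
  -- `x` gives way to `none`; `v` stays in the edge as the vertex to be separated from `none`.
  obtain ⟨x, hx, v, hv, hxv⟩ := one_lt_card.1 (show 1 < #e by omega)
  set e' : Finset (Option V) := insertNone (e.erase x) with he'
  set g : Finset V → Finset (Option V) := fun f => if f = e then e' else f.map .some with hg
  have hge : g e = e' := if_pos rfl
  have hgne : ∀ f, f ≠ e → g f = f.map .some := fun f hf => if_neg hf
  have hsome : ∀ f w, some w ∈ g f → w ∈ f := by
    intro f w hw
    by_cases hf : f = e
    · subst hf
      rw [hge, he', some_mem_insertNone] at hw
      exact mem_of_mem_erase hw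
    · rw [hgne f hf] at hw
      simpa using hw
  have hnone : ∀ f, none ∈ g f → f = e := by
    intro f hf
    by_contra hne
    rw [hgne f hne] at hf
    simp at hf
  have hdegnone : ({f ∈ M.image g | none ∈ f} : Finset _) = {e'} := by
    ext f
    simp only [mem_filter, mem_image, mem_singleton]
    constructor
    · rintro ⟨⟨f, hf, rfl⟩, hn⟩
      rw [hnone f hn, hge]
    · rintro rfl
      exact ⟨⟨e, heM, hge⟩, by simp [he']⟩
  refine ⟨M.image g, ⟨?_, ?_, ?_⟩, ?_, ?_, v, ?_⟩
  · intro f' hf'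
    obtain ⟨f, hf, rfl⟩ := mem_image.1 hf'
    by_cases hfe : f = e
    · rw [hfe, hge, he', card_insertNone, card_erase_of_mem hx]
      omega
    · rw [hgne f hfe, card_map, hE.card_eq f (hME hf)]
  · intro f' hf' h' hh' hne
    obtain ⟨f, hf, rfl⟩ := mem_image.1 hf'
    obtain ⟨h, hh, rfl⟩ := mem_image.1 hh'
    have hfh : f ≠ h := fun H => hne (H ▸ rfl)
    -- `none` lies only in `e'`, so intersections of distinct new edges come from intersections of
    -- old ones.
    refine le_trans ?_ (hE.card_inter_le f (hME hf) h (hME hh) hfh)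
    rw [← card_map (s := f ∩ h) Function.Embedding.some]
    refine card_le_card fun w hw => ?_
    rw [mem_inter] at hw
    cases w with
    | none => exact absurd ((hnone f hw.1).trans (hnone h hw.2).symm) hfh
    | some w => simpa using ⟨hsome f w hw.1, hsome h w hw.2⟩
  · intro w
    cases w with
    | none =>
      rw [hdegnone, card_singleton]
      exact hD
    | some w =>
      have hsub : {f ∈ M.image g | some w ∈ f} ⊆ {f ∈ E | w ∈ f}.image g := by
        intro f' hf'
        simp only [mem_filter, mem_image] at hf' ⊢
        obtain ⟨⟨f, hf, rfl⟩, hw⟩ := hf'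
        exact ⟨f, ⟨hME hf, hsome f w hw⟩, rfl⟩
      exact (card_le_card hsub).trans (card_image_le.trans (hE.degree_le w))
  · have : Nontrivial (Fin q) := Fin.nontrivial_iff_two_le.2 hq
    -- Colouring `none` differently from `v` breaks `e'`, while `τ` already handles the other edges.
    obtain ⟨c, hc⟩ := exists_ne (τ v)
    refine ⟨fun w => w.elim c τ, fun f' hf' hm => ?_⟩
    obtain ⟨f, hf, rfl⟩ := mem_image.1 hf'
    by_cases hfe : f = e
    · rw [hfe, hge] at hm
      exact hc (hm none (by simp [he']) (some v) (by simp [he', hv, hxv.symm]))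
    · rw [hgne f hfe] at hm
      exact hτ f (mem_erase.2 ⟨hfe, hf⟩) fun y hy z hz =>
        hm (some y) (by simpa using hy) (some z) (by simpa using hz)
  · rw [hdegnone, card_singleton]
  · intro σ hσ heq
    -- The edges other than `e` are untouched, so `σ` is constant on `e`; if `none` shared the
    -- colour of `v`, then `e'` would be monochromatic.
    have hm := hmono (fun w => σ (some w)) fun f hf hm => by
      rw [mem_erase] at hf
      refine hσ (g f) (mem_image_of_mem g hf.2) ?_
      rw [hgne f hf.1]
      intro y hy z hz
      obtain ⟨y, hy', rfl⟩ := mem_map.1 hy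
      obtain ⟨z, hz', rfl⟩ := mem_map.1 hz
      exact hm y hy' z hz'
    have hall : ∀ y ∈ e', σ y = σ (some v) := by
      intro y hy
      cases y with
      | none => exact heq
      | some y =>
        rw [he', some_mem_insertNone] at hy
        exact hm y (mem_of_mem_erase hy) v hv
    refine hσ e' (hge ▸ mem_image_of_mem g heM) fun y hy z hz => ?_
    rw [hall y hy, hall z hz]

/-! ### Stars, which attain the maximum degree -/

/-- The star with `D` edges, each consisting of the centre `none` and `k` leaves. -/
noncomputable def starFamily (D k : ℕ) : Finset (Finset (Option (Fin D × Fin k))) :=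
  univ.image fun j => insertNone (univ.map (.sectR j (Fin k)))

lemma mem_starFamily {D k : ℕ} {e : Finset (Option (Fin D × Fin k))} :
    e ∈ starFamily D k ↔ ∃ j, insertNone (univ.map (.sectR j (Fin k))) = e := by
  simp [starFamily]

lemma card_starFamily_filter_none {D k : ℕ} (hk : 1 ≤ k) :
    #{e ∈ starFamily D k | none ∈ e} = D := by
  have hall : {e ∈ starFamily D k | none ∈ e} = starFamily D k := by
    refine filter_true_of_mem fun e he => ?_
    obtain ⟨j, rfl⟩ := mem_starFamily.1 he
    simp
  rw [hall, starFamily, card_image_of_injective, card_univ, Fintype.card_fin]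
  intro i j hij
  have hmem : some (i, (⟨0, hk⟩ : Fin k)) ∈ insertNone (univ.map (.sectR i (Fin k))) := by simp
  have hij' : insertNone (univ.map (.sectR i (Fin k))) =
    insertNone (univ.map (.sectR j (Fin k))) := hij
  rw [hij'] at hmem
  simpa [eq_comm] using hmem

lemma isLinearFamily_starFamily {D k : ℕ} (hk : 1 ≤ k) :
    IsLinearFamily (k + 1) D (starFamily D k) where
  card_eq e he := by
    obtain ⟨j, rfl⟩ := mem_starFamily.1 he
    simp
  card_inter_le e he f hf hef := by
    obtain ⟨i, rfl⟩ := mem_starFamily.1 he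
    obtain ⟨j, rfl⟩ := mem_starFamily.1 hf
    have hij : i ≠ j := fun h => hef (h ▸ rfl)
    rw [card_le_one_iff_subset_singleton]
    refine ⟨none, fun w hw => ?_⟩
    cases w with
    | none => simp
    | some w =>
      simp only [mem_inter, some_mem_insertNone, mem_map, mem_univ, true_and,
        Function.Embedding.sectR_apply] at hw
      obtain ⟨⟨a, rfl⟩, b, hb⟩ := hw
      exact absurd (congrArg Prod.fst hb).symm hij
  degree_le w := by
    refine le_trans (card_le_card fun e he => ?_) (card_starFamily_filter_none (D := D) hk).le
    rw [mem_filter] at he ⊢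
    obtain ⟨j, rfl⟩ := mem_starFamily.1 he.1
    exact ⟨he.1, by simp⟩

lemma exists_colouring_starFamily {D k q : ℕ} (hk : 1 ≤ k) (hq : 2 ≤ q) :
    ∃ σ : Option (Fin D × Fin k) → Fin q, ∀ e ∈ starFamily D k, ¬ IsMonochromatic σ e := by
  refine ⟨fun w => w.elim ⟨0, by omega⟩ fun _ => ⟨1, by omega⟩, fun e he hm => ?_⟩
  obtain ⟨j, rfl⟩ := mem_starFamily.1 he
  have := hm none (by simp) (some (j, ⟨0, hk⟩)) (by simp)
  simp at this

/-! ### Disjoint unions -/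

variable {V W : Type*} [DecidableEq V] [DecidableEq W]

/-- The disjoint union of two families of sets. -/
def sumFamily (E : Finset (Finset V)) (F : Finset (Finset W)) : Finset (Finset (V ⊕ W)) :=
  E.image (Finset.map .inl) ∪ F.image (Finset.map .inr)

lemma mem_sumFamily {E : Finset (Finset V)} {F : Finset (Finset W)} {e : Finset (V ⊕ W)} :
    e ∈ sumFamily E F ↔ (∃ f ∈ E, f.map .inl = e) ∨ ∃ f ∈ F, f.map .inr = e := by
  simp [sumFamily]

lemma card_sumFamily_filter_inl (E : Finset (Finset V)) (F : Finset (Finset W)) (v : V) :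
    #{e ∈ sumFamily E F | .inl v ∈ e} = #{e ∈ E | v ∈ e} := by
  rw [← card_image_of_injective {e ∈ E | v ∈ e}
    (Finset.map_injective (Function.Embedding.inl (α := V) (β := W)))]
  congr 1
  ext e
  simp only [mem_filter, mem_sumFamily, mem_image]
  constructor
  · rintro ⟨⟨f, hf, rfl⟩ | ⟨f, hf, rfl⟩, hv⟩
    · exact ⟨f, ⟨hf, by simpa using hv⟩, rfl⟩
    · simp at hv
  · rintro ⟨f, ⟨hf, hv⟩, rfl⟩
    exact ⟨Or.inl ⟨f, hf, rfl⟩, by simpa using hv⟩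

lemma card_sumFamily_filter_inr (E : Finset (Finset V)) (F : Finset (Finset W)) (w : W) :
    #{e ∈ sumFamily E F | .inr w ∈ e} = #{e ∈ F | w ∈ e} := by
  rw [← card_image_of_injective {e ∈ F | w ∈ e}
    (Finset.map_injective (Function.Embedding.inr (α := V) (β := W)))]
  congr 1
  ext e
  simp only [mem_filter, mem_sumFamily, mem_image]
  constructor
  · rintro ⟨⟨f, hf, rfl⟩ | ⟨f, hf, rfl⟩, hv⟩
    · simp at hv
    · exact ⟨f, ⟨hf, by simpa using hv⟩, rfl⟩
  · rintro ⟨f, ⟨hf, hv⟩, rfl⟩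
    exact ⟨Or.inr ⟨f, hf, rfl⟩, by simpa using hv⟩

lemma IsLinearFamily.sumFamily {K D : ℕ} {E : Finset (Finset V)} {F : Finset (Finset W)}
    (hE : IsLinearFamily K D E) (hF : IsLinearFamily K D F) :
    IsLinearFamily K D (sumFamily E F) where
  card_eq e he := by
    obtain ⟨f, hf, rfl⟩ | ⟨f, hf, rfl⟩ := mem_sumFamily.1 he
    · rw [card_map, hE.card_eq f hf]
    · rw [card_map, hF.card_eq f hf]
  card_inter_le e he f hf hef := by
    obtain ⟨e, he', rfl⟩ | ⟨e, he', rfl⟩ := mem_sumFamily.1 he <;>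
      obtain ⟨f, hf', rfl⟩ | ⟨f, hf', rfl⟩ := mem_sumFamily.1 hf
    · rw [← map_inter, card_map]
      exact hE.card_inter_le e he' f hf' fun h => hef (h ▸ rfl)
    · rw [disjoint_iff_inter_eq_empty.1 (disjoint_map_inl_map_inr e f), card_empty]
      exact zero_le_one
    · rw [disjoint_iff_inter_eq_empty.1 (disjoint_map_inl_map_inr f e).symm, card_empty]
      exact zero_le_one
    · rw [← map_inter, card_map]
      exact hF.card_inter_le e he' f hf' fun h => hef (h ▸ rfl)
  degree_le v := by
    cases v with
    | inl v => exact (card_sumFamily_filter_inl E F v).trans_le (hE.degree_le v)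
    | inr w => exact (card_sumFamily_filter_inr E F w).trans_le (hF.degree_le w)

end Gadget

/-! ### From finite families to hypergraphs -/

/-- The hypergraph on all of `V` whose hyperedges are the members of `E`. -/
def Hypergraph.ofFinsets {V : Type*} (E : Finset (Finset V)) : Hypergraph V where
  vertexSet := Set.univ
  edgeSet := (fun e : Finset V => (e : Set V)) '' E
  subset_vertexSet_of_mem_edgeSet' _ _ := Set.subset_univ _

namespace Hypergraph

variable {V : Type*} {E : Finset (Finset V)}

lemma vertexDegree_ofFinsets [DecidableEq V] (v : V) :
    (ofFinsets E).vertexDegree v = #{e ∈ E | v ∈ e} := by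
  have : {e ∈ (ofFinsets E).edgeSet | v ∈ e} =
      (fun e : Finset V => (e : Set V)) '' ({e ∈ E | v ∈ e} : Finset _) := by
    ext s
    simp only [ofFinsets, Set.mem_image, Set.mem_ofPred_eq, coe_filter, mem_coe]
    constructor
    · rintro ⟨⟨e, he, rfl⟩, hv⟩
      exact ⟨e, ⟨he, hv⟩, rfl⟩
    · rintro ⟨e, ⟨he, hv⟩, rfl⟩
      exact ⟨⟨e, he, rfl⟩, hv⟩
  rw [vertexDegree, this, Set.ncard_image_of_injective _ coe_injective, Set.ncard_coe_finset]

lemma properColouring_ofFinsets {q : ℕ} {σ : V → Fin q} :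
    (ofFinsets E).ProperColouring σ ↔ ∀ e ∈ E, ¬ IsMonochromatic σ e := by
  simp [ProperColouring, ofFinsets, IsMonochromatic]

end Hypergraph

namespace IsLinearFamily

variable {V : Type*} [DecidableEq V] {E : Finset (Finset V)} {K D : ℕ}

lemma kUniform (hE : IsLinearFamily K D E) : (Hypergraph.ofFinsets E).KUniform K := by
  rintro _ ⟨e, he, rfl⟩
  exact (Set.ncard_coe_finset e).trans (hE.card_eq e he)

lemma simple (hE : IsLinearFamily K D E) : (Hypergraph.ofFinsets E).Simple := by
  rintro _ ⟨e, he, rfl⟩ _ ⟨f, hf, rfl⟩ hef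
  simp only [← coe_inter, Set.encard_coe_eq_coe_finsetCard]
  exact_mod_cast hE.card_inter_le e he f hf fun h => hef (h ▸ rfl)

end IsLinearFamily

/-! ### Choice of parameters and assembly -/

theorem mainTheorem8 (q K : ℕ) (hq : 2 ≤ q) (hK : 2 ≤ K) (Δ : ℕ)
    (hΔ : (K : ℝ) * (q : ℝ) ^ (K - 1) * Real.log (q : ℝ) + 1 < (Δ : ℝ)) :
    ∃ (V : Type) (_ : Finite V) (H : Hypergraph V),
      H.vertexSet = Set.univ ∧ H.KUniform K ∧ H.Simple ∧ H.HasMaxDegree Δ ∧ H.QColourable q ∧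
      ∃ u v : V, u ≠ v ∧ H.vertexDegree u = 1 ∧ H.vertexDegree v ≤ Δ ∧
        ∀ σ : V → Fin q, H.ProperColouring σ → σ u ≠ σ v := by
  have hqpos : (0 : ℝ) < q := by positivity
  have hlog : 0 < Real.log q := Real.log_pos (by exact_mod_cast hq)
  have hΔpos : (0 : ℝ) < Δ := by
    have : 0 < (K : ℝ) * (q : ℝ) ^ (K - 1) * Real.log q := by positivity
    linarith
  have hΔ1 : 1 ≤ Δ := by exact_mod_cast hΔpos
  -- The lower bound makes `q ^ K * exp (-δ * Δ) < 1`; the upper bound is what the averaging step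
  -- needs. The hypothesis on `Δ` makes the interval nonempty.
  obtain ⟨δ, hδ, hδq⟩ : ∃ δ, K * Real.log q / Δ < δ ∧ δ < 1 / (q : ℝ) ^ (K - 1) := by
    refine exists_between ?_
    rw [div_lt_div_iff₀ hΔpos (by positivity)]
    linarith
  have hδ0 : 0 < δ := lt_trans (by positivity) hδ
  rw [div_lt_iff₀ hΔpos] at hδ
  have hδ1 : δ < 1 := hδq.trans_le (by
    rw [div_le_one (by positivity)]
    exact one_le_pow₀ (by exact_mod_cast hq.trans' one_le_two))
  have hsmall : (q : ℝ) ^ K * (1 - δ) ^ Δ < 1 := by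
    calc (q : ℝ) ^ K * (1 - δ) ^ Δ ≤ Real.exp (Real.log q) ^ K * Real.exp (-δ) ^ Δ := by
          rw [Real.exp_log hqpos]
          exact mul_le_mul_of_nonneg_left
            (pow_le_pow_left₀ (by linarith) (Real.one_sub_le_exp_neg δ) Δ) (by positivity)
      _ = Real.exp (K * Real.log q - δ * Δ) := by
          rw [← Real.exp_nat_mul, ← Real.exp_nat_mul, ← Real.exp_add]
          ring_nf
      _ < 1 := Real.exp_lt_one_iff.2 (by linarith)
  obtain ⟨n, E, hE, hcol⟩ :=
    exists_isLinearFamily_not_colourable (by omega) hK hδ0 hδq hsmall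
  obtain ⟨F, hF, ⟨τ, hτ⟩, hdeg, v, hsep⟩ := hE.exists_separating hq hK hΔ1 hcol
  obtain ⟨k, rfl⟩ : ∃ k, K = k + 1 := ⟨K - 1, by omega⟩
  have hk : 1 ≤ k := by omega
  obtain ⟨ρ, hρ⟩ := exists_colouring_starFamily (D := Δ) hk hq
  have hU := hF.sumFamily (isLinearFamily_starFamily (D := Δ) hk)
  -- The centre of the star attains degree `Δ`; both separated vertices lie in the other component.
  refine ⟨_, inferInstance, .ofFinsets (sumFamily F (starFamily Δ k)), rfl, hU.kUniform,
    hU.simple, ⟨⟨.inr none, trivial, ?_⟩, ?_⟩, ⟨Sum.elim τ ρ, ?_⟩, .inl none, .inl (some v),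
    by simp, ?_, ?_, ?_⟩
  · rw [Hypergraph.vertexDegree_ofFinsets, card_sumFamily_filter_inr]
    exact card_starFamily_filter_none hk
  · rintro _ ⟨w, -, rfl⟩
    rw [Hypergraph.vertexDegree_ofFinsets]
    exact hU.degree_le w
  · rw [Hypergraph.properColouring_ofFinsets]
    intro e he
    obtain ⟨f, hf, rfl⟩ | ⟨f, hf, rfl⟩ := mem_sumFamily.1 he
    · rw [isMonochromatic_map]
      exact hτ f hf
    · rw [isMonochromatic_map]
      exact hρ f hf
  · rw [Hypergraph.vertexDegree_ofFinsets, card_sumFamily_filter_inl]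
    exact hdeg
  · rw [Hypergraph.vertexDegree_ofFinsets]
    exact hU.degree_le _
  · intro σ hσ
    rw [Hypergraph.properColouring_ofFinsets] at hσ
    refine hsep (σ ∘ .inl) fun e he hm => ?_
    exact hσ _ (mem_sumFamily.2 (Or.inl ⟨e, he, rfl⟩)) ((isMonochromatic_map σ .inl e).2 hm)
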